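/- **Definitions.** A *polyhedral cell* in $\mathbb{R}^n$ is a compact set $c$, not necessarily convex, that is the closure of its interior, has connected interior, and whose boundary lies in finitely many hyperplanes. A boundary point of $c$ is *flat* with outward unit normal $\nu$ if near it $c$ coincides with a half-space with outward normal $\nu$; a *facet* of $c$ with outward normal $\nu$ is the closure of a connected component of the set of flat points with outward normal $\nu$. Two distinct facets of $c$ *meet at angle* $\theta\in(0,2\pi)$ if they share a ridge (of dimension $n-2$) along which they bound a wedge of $c$ of interior angle $\theta$; if $\nu_1,\nu_2$ are their outward normals, this angle is $\pi-\angle(\nu_1,\nu_2)$ (convex) or $\pi+\angle(\nu_1,\nu_2)$ (reentrant). The angle is called *obtuse* if $\nu_1\cdot\nu_2>0$. A *tessellation of $\mathbb{R}^n$ by shifts of $c$* is a set $T$ of translates of $c$ that cover $\mathbb{R}^n$ and have pairwise disjoint interiors; $\chi(T)$ is the set of indicator functions of its cells. A finite family $\{T_j\}_{j=0..J}$ of tessellations is *efficient* if, for any three distinct pairs consisting of a cell in $\bigcup_j T_j$ and a facet of that cell, the intersection of the three facets has codimension greater than $1$. The union $\bigcup_j\chi(T_j)$ is *refinable* if there are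 $h\in(0,1)$ and $t\in\mathbb{R}^n$ such that the indicator function of every cell of every $T_j$ equals, almost everywhere, a finite real linear combination of indicator functions of sets $h d+t$ with $d\in\bigcup_i T_i$. **Proposition.** Let $\{T_j\}_{j=0..J}$ be an efficient family of tessellations of $\mathbb{R}^n$ by shifts of one polyhedral cell $c\in T_0$. Suppose that two facets $f_a$ and $f_b$ of $c$ meet at an obtuse angle $\gamma$, that no facet of $c$ meets $f_b$ at an angle less than $\pi-\gamma$, and that the reflection of $c$ across the hyperplane through $f_b$ is a cell of $T_0$. Then $\bigcup_{j=0..J}\chi(T_j)$ is not refinable. -/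

import Mathlib

open Set MeasureTheory
open scoped RealInnerProductSpace

noncomputable section

/-- `n`-dimensional Euclidean space. -/
abbrev Sp (n : ℕ) : Type := EuclideanSpace ℝ (Fin n)

/-- A polyhedral cell, not necessarily convex: a compact solid body with connected interior whose
boundary lies in finitely many hyperplanes `{y | ⟪ν, y⟫ = b}`, `ν ≠ 0`. (A regular closed compact
set with such a boundary is a finite union of `n`-dimensional convex polytopes.) -/
structure IsPolyhedralCell {n : ℕ} (c : Set (Sp n)) : Prop where
  isCompact : IsCompact c
  regular : closure (interior c) = c
  connected : IsConnected (interior c)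
  polyhedral : ∃ H : Finset (Sp n × ℝ), (∀ p ∈ H, p.1 ≠ 0) ∧
    ∀ x ∈ frontier c, ∃ p ∈ H, ⟪p.1, x⟫ = p.2

/-- The points near which `c` is a half-space with outward normal `ν`. -/
def flatPoints {n : ℕ} (c : Set (Sp n)) (ν : Sp n) : Set (Sp n) :=
  {x | ∃ ε > 0, ∀ y ∈ Metric.ball x ε, y ∈ c ↔ ⟪ν, y - x⟫ ≤ 0}

/-- `f` is a facet of `c` with outward unit normal `ν`: the closure of a connected component of
the set of boundary points at which `c` is flat with outward normal `ν`. -/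
def IsFacet {n : ℕ} (c : Set (Sp n)) (ν : Sp n) (f : Set (Sp n)) : Prop :=
  ‖ν‖ = 1 ∧ ∃ x ∈ flatPoints c ν, f = closure (connectedComponentIn (flatPoints c ν) x)

/-- Two distinct facets `f`, `g` of `c` with outward unit normals `ν`, `μ` abut, and `θ` is the
angle that they enclose inside `c`. Near a point `p` of the common ridge, `f` and `g` are the sides
of a wedge contained in `c`: either a convex one, of angle `π - ∠(ν, μ)`, or a reentrant
one, of angle `π + ∠(ν, μ)`. -/
def MeetAtAngle {n : ℕ} (c : Set (Sp n)) (ν : Sp n) (f : Set (Sp n)) (μ : Sp n) (g : Set (Sp n))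
    (θ : ℝ) : Prop :=
  IsFacet c ν f ∧ IsFacet c μ g ∧ f ≠ g ∧ ∃ p, ∃ ε > 0,
    (θ = Real.pi - InnerProductGeometry.angle ν μ ∧ ∀ y ∈ Metric.ball p ε,
      (⟪ν, y - p⟫ = 0 → ⟪μ, y - p⟫ ≤ 0 → y ∈ f) ∧
      (⟪μ, y - p⟫ = 0 → ⟪ν, y - p⟫ ≤ 0 → y ∈ g) ∧
      (⟪ν, y - p⟫ ≤ 0 ∧ ⟪μ, y - p⟫ ≤ 0 → y ∈ c)) ∨
    (θ = Real.pi + InnerProductGeometry.angle ν μ ∧ ∀ y ∈ Metric.ball p ε,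
      (⟪ν, y - p⟫ = 0 → 0 ≤ ⟪μ, y - p⟫ → y ∈ f) ∧
      (⟪μ, y - p⟫ = 0 → 0 ≤ ⟪ν, y - p⟫ → y ∈ g) ∧
      (⟪ν, y - p⟫ ≤ 0 ∨ ⟪μ, y - p⟫ ≤ 0 → y ∈ c))

/-- `T` is a tessellation of space whose cells are translates of `c`: the cells cover, and distinct
cells do not overlap in interior points. -/
def IsTessellationByShifts {n : ℕ} (c : Set (Sp n)) (T : Set (Set (Sp n))) : Prop :=
  (∀ d ∈ T, ∃ v : Sp n, d = (fun x => x + v) '' c) ∧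
  ⋃₀ T = univ ∧
  T.Pairwise fun d d' => Disjoint (interior d) (interior d')

/-- `S` contains no piece (disc) of a hyperplane. For intersections of facets, which are finite
unions of convex polytopes, this says that the codimension is greater than one. -/
def CodimGTOne {n : ℕ} (S : Set (Sp n)) : Prop :=
  ∀ (ν x : Sp n) (ε : ℝ), ν ≠ 0 → 0 < ε → ¬ {y ∈ Metric.ball x ε | ⟪ν, y - x⟫ = 0} ⊆ S

/-- A family of tessellations is efficient if the intersection of more than two cell facets has
codimension greater than one. A cell facet is a cell together with one of its facets, so that a
facet shared by two adjacent cells counts twice. -/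
def IsEfficient {n J : ℕ} (T : Fin (J + 1) → Set (Set (Sp n))) : Prop :=
  ∀ (d f : Fin 3 → Set (Sp n)) (ν : Fin 3 → Sp n),
    (∀ i, d i ∈ ⋃ j, T j) → (∀ i, IsFacet (d i) (ν i) (f i)) →
    (Function.Injective fun i => (d i, f i)) → CodimGTOne (⋂ i, f i)

/-- The homothetic copy `h • T + t` of a tessellation. -/
def scaledCopy {n : ℕ} (h : ℝ) (t : Sp n) (T : Set (Set (Sp n))) : Set (Set (Sp n)) :=
  (fun d => (fun x => h • x + t) '' d) '' T

/-- The linear combinations of indicator functions of the cells in `S`. -/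
def cellSpan {n : ℕ} (S : Set (Set (Sp n))) : Submodule ℝ (Sp n → ℝ) :=
  Submodule.span ℝ ((fun d => d.indicator fun _ => (1 : ℝ)) '' S)

/-- The union of the indicator spaces of the `T j` is refinable: for some scaled-down copy of the
family, the indicator function of every cell is, up to null sets (in particular irrespective of
which cell owns the boundary points), a linear combination of indicators of scaled cells. -/
def IsRefinable {n J : ℕ} (T : Fin (J + 1) → Set (Set (Sp n))) : Prop :=
  ∃ (h : ℝ) (t : Sp n), 0 < h ∧ h < 1 ∧ ∀ j, ∀ d ∈ T j,
    ∃ s ∈ cellSpan (⋃ i, scaledCopy h t (T i)),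
      s =ᵐ[volume] d.indicator fun _ => (1 : ℝ)

/-- Reflection across the hyperplane through `q` with normal `ν`. -/
def reflectAcross {n : ℕ} (ν q x : Sp n) : Sp n :=
  (ℝ ∙ ν)ᗮ.reflection (x - q) + q

end

/-! Write `φ` for the indicator of the cell and `ν` for the normal of `fb`. Refinability makes `φ`
a.e. a finite combination of functions `φ (h⁻¹ • (x - w))`. The reflected cell is a translate of
`c`, and `c` is bounded, so `c` is symmetric in a hyperplane with normal `ν`.

Split `φ` along lines of direction `ν`. Let `ψ` collect the jumps of `φ` at the finitely many
candidate heights of facets perpendicular to `ν`; then `φ - ψ` has no jump at any fixed height on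
almost every line. Dilations and translations respect both kinds of function, and a function of
bounded support that is of both kinds vanishes. By symmetry the jumps on each line cancel in pairs,
so `ψ` has bounded support, and therefore it satisfies the refinement equation of `φ` with the same
coefficients.

Such an equation has at most one bounded solution of bounded support up to a factor: if the integral
vanishes, so do all moments, by induction on the degree. Hence `ψ = l * φ` a.e. If `l = 0`, then `φ`
does not jump across the facet with normal `ν`; if `l ≠ 0`, it does not jump across the oblique
facet `fa`. Both are absurd (`IsPolyhedralCell.not_refinement`). -/

/-! ### Moments and uniqueness for refinement equations -/

theorem integrable_of_bounded_support {n : ℕ} {E : Sp n → ℝ} {C R : ℝ} (hm : Measurable E)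
    (hC : ∀ x, |E x| ≤ C) (hR : ∀ x, R < ‖x‖ → E x = 0) : Integrable E := by
  refine IntegrableOn.integrable_of_forall_notMem_eq_zero (s := Metric.closedBall 0 R) ?_ ?_
  · exact Measure.integrableOn_of_bounded (M := C) measure_closedBall_lt_top.ne
      hm.aestronglyMeasurable (Filter.Eventually.of_forall fun x => by simpa using hC x)
  · intro x hx
    exact hR x (by simpa using hx)

/-- The exponential series may be integrated term by term, because on the support of `E` its terms
are dominated by those of the series of `exp (R * ‖u‖)`. -/
theorem integral_exp_inner_eq_zero {n : ℕ} {E : Sp n → ℝ} {C R : ℝ} (hm : Measurable E)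
    (hC : ∀ x, |E x| ≤ C) (hR : ∀ x, R < ‖x‖ → E x = 0) (u : Sp n)
    (hmom : ∀ k : ℕ, ∫ x, ⟪x, u⟫ ^ k * E x = 0) :
    ∫ x, Complex.exp (⟪x, u⟫ * Complex.I) * (E x : ℂ) = 0 := by
  have hint := integrable_of_bounded_support hm hC hR
  have hs : HasSum (fun k : ℕ => ∫ x, ((⟪x, u⟫ * Complex.I) ^ k / (k.factorial : ℂ)) * (E x : ℂ))
      (∫ x, Complex.exp (⟪x, u⟫ * Complex.I) * (E x : ℂ)) := by
    refine hasSum_integral_of_dominated_convergence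
      (fun k x => ((R * ‖u‖) ^ k / (k.factorial : ℝ)) * |E x|) ?_ ?_ ?_ ?_ ?_
    · intro k
      exact (by fun_prop : Measurable _).aestronglyMeasurable
    · intro k
      refine Filter.Eventually.of_forall fun x => ?_
      by_cases hx : R < ‖x‖
      · simp [hR x hx]
      · have h1 : |⟪x, u⟫| ≤ R * ‖u‖ := (abs_real_inner_le_norm x u).trans
          (mul_le_mul_of_nonneg_right (not_lt.mp hx) (norm_nonneg _))
        simp only [norm_mul, norm_div, norm_pow, Complex.norm_real, Complex.norm_I, mul_one,
          Complex.norm_natCast, Real.norm_eq_abs]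
        gcongr
    · refine Filter.Eventually.of_forall fun x => ?_
      exact (Real.summable_pow_div_factorial _).mul_right _
    · simp_rw [tsum_mul_right]
      exact hint.abs.const_mul _
    · refine Filter.Eventually.of_forall fun x => ?_
      have he : HasSum (fun k : ℕ => (⟪x, u⟫ * Complex.I : ℂ) ^ k / (k.factorial : ℂ))
          (Complex.exp (⟪x, u⟫ * Complex.I)) := by
        rw [Complex.exp_eq_exp_ℂ]
        exact NormedSpace.expSeries_div_hasSum_exp (⟪x, u⟫ * Complex.I : ℂ)
      exact he.mul_right _
  have hz : (fun k : ℕ => ∫ x, ((⟪x, u⟫ * Complex.I) ^ k / (k.factorial : ℂ)) * (E x : ℂ))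
      = fun _ => 0 := by
    funext k
    have : ∀ x, ((⟪x, u⟫ * Complex.I) ^ k / (k.factorial : ℂ)) * (E x : ℂ)
        = (Complex.I ^ k / (k.factorial : ℂ)) * ((⟪x, u⟫ ^ k * E x : ℝ) : ℂ) := by
      intro x; push_cast; ring
    simp_rw [this]
    rw [integral_const_mul, integral_complex_ofReal, hmom]
    simp
  rw [hz] at hs
  exact hs.unique hasSum_zero

/-- A function with bounded support is determined by the integrals of its products with powers of
linear functionals. -/
theorem ae_eq_zero_of_moments {n : ℕ} {E : Sp n → ℝ} {C R : ℝ} (hm : Measurable E)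
    (hC : ∀ x, |E x| ≤ C) (hR : ∀ x, R < ‖x‖ → E x = 0)
    (hmom : ∀ (u : Sp n) (k : ℕ), ∫ x, ⟪x, u⟫ ^ k * E x = 0) : E =ᵐ[volume] 0 := by
  have hint := integrable_of_bounded_support hm hC hR
  have hexp := fun u => integral_exp_inner_eq_zero hm hC hR u (hmom u)
  -- The positive and negative parts of `E` are densities of finite measures; vanishing of the
  -- Fourier transform of `E` says that their characteristic functions agree.
  set P : Measure (Sp n) := volume.withDensity fun x => ENNReal.ofReal (E x) with hP
  set N : Measure (Sp n) := volume.withDensity fun x => ENNReal.ofReal (-E x) with hN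
  have : IsFiniteMeasure P := isFiniteMeasure_withDensity_ofReal hint.2
  have : IsFiniteMeasure N := isFiniteMeasure_withDensity_ofReal hint.neg.2
  have hPN : P = N := by
    apply Measure.ext_of_charFun
    funext u
    rw [charFun_apply, charFun_apply, hP, hN,
      integral_withDensity_eq_integral_toReal_smul (by fun_prop) (by simp),
      integral_withDensity_eq_integral_toReal_smul (by fun_prop) (by simp), ← sub_eq_zero,
      ← integral_sub, ← hexp u]
    · congr 1
      funext x
      simp only [ENNReal.toReal_ofReal', Complex.real_smul, ← sub_mul]
      rw [mul_comm, ← Complex.ofReal_sub, max_zero_sub_eq_self]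
    all_goals
      simp only [ENNReal.toReal_ofReal']
      refine Integrable.mono' (hint.abs) (by fun_prop) (Filter.Eventually.of_forall fun x => ?_)
      rw [norm_smul, Complex.norm_exp_ofReal_mul_I, mul_one, Real.norm_eq_abs,
        abs_of_nonneg (le_max_right _ _)]
      exact max_le (by first | exact le_abs_self _ | exact neg_le_abs _) (abs_nonneg _)
  have := (withDensity_eq_iff_of_sigmaFinite (by fun_prop) (by fun_prop)).mp hPN
  filter_upwards [this] with x hx
  have h2 := congrArg ENNReal.toReal hx
  simp only [ENNReal.toReal_ofReal'] at h2
  have := max_zero_sub_eq_self (E x)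
  simp only [Pi.zero_apply]
  linarith

theorem integral_dilation {n : ℕ} (F : Sp n → ℝ) {h : ℝ} (h0 : 0 < h) (w : Sp n) :
    ∫ x, F (h⁻¹ • (x - w)) = h ^ n * ∫ x, F x := by
  rw [integral_sub_right_eq_self (fun x => F (h⁻¹ • x)) w,
    Measure.integral_comp_inv_smul_of_nonneg volume F h0.le, finrank_euclideanSpace_fin,
    smul_eq_mul]

/-- The only solution of a refinement equation with bounded support and vanishing integral is
zero. -/
theorem ae_eq_zero_of_refinement {n m : ℕ} {E : Sp n → ℝ} {C R h : ℝ} (hm : Measurable E)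
    (hC : ∀ x, |E x| ≤ C) (hR : ∀ x, R < ‖x‖ → E x = 0) (h0 : 0 < h) (h1 : h < 1)
    (a : Fin m → ℝ) (w : Fin m → Sp n) (ha : (∑ i, a i) * h ^ n = 1)
    (href : E =ᵐ[volume] fun x => ∑ i, a i * E (h⁻¹ • (x - w i)))
    (hE : ∫ x, E x = 0) : E =ᵐ[volume] 0 := by
  have hint : ∀ p : Sp n → ℝ, Continuous p → Integrable fun x => p x * E x := by
    intro p hp
    refine IntegrableOn.integrable_of_forall_notMem_eq_zero (s := Metric.closedBall 0 R) ?_ ?_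
    · obtain ⟨D, hD⟩ := (isCompact_closedBall (0 : Sp n) R).exists_bound_of_continuousOn
        hp.continuousOn
      refine Measure.integrableOn_of_bounded (M := D * C) measure_closedBall_lt_top.ne
        (by fun_prop) ?_
      filter_upwards [ae_restrict_mem Metric.isClosed_closedBall.measurableSet] with x hx
      rw [norm_mul]
      exact mul_le_mul (hD x hx) (hC x) (norm_nonneg _) ((norm_nonneg _).trans (hD x hx))
    · intro x hx
      rw [hR x (by simpa using hx), mul_zero]
  have hchange : ∀ (p : Sp n → ℝ) (v : Sp n),
      ∫ x, p x * E (h⁻¹ • (x - v)) = h ^ n * ∫ x, p (h • x + v) * E x := by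
    intro p v
    rw [← integral_dilation (fun z => p (h • z + v) * E z) h0 v]
    simp [smul_smul, h0.ne']
  refine ae_eq_zero_of_moments hm hC hR fun u k => ?_
  induction k using Nat.strong_induction_on with
  | _ k ih =>
  rcases Nat.eq_zero_or_pos k with rfl | hk
  · simpa using hE
  -- After substitution and binomial expansion only the top term survives, the lower moments being
  -- zero by induction. It carries the factor `h ^ k`, which is less than `1` as `k > 0`.
  have key : ∀ i, ∫ x, ⟪x, u⟫ ^ k * E (h⁻¹ • (x - w i))
      = h ^ n * (h ^ k * ∫ x, ⟪x, u⟫ ^ k * E x) := by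
    intro i
    rw [hchange]
    congr 1
    have e : ∀ x : Sp n, ⟪h • x + w i, u⟫ ^ k * E x = ∑ j ∈ Finset.range (k + 1),
        (h ^ j * ⟪w i, u⟫ ^ (k - j) * (k.choose j)) * (⟪x, u⟫ ^ j * E x) := by
      intro x
      rw [inner_add_left, real_inner_smul_left, add_pow, Finset.sum_mul]
      refine Finset.sum_congr rfl fun j _ => ?_
      rw [mul_pow]; ring
    simp_rw [e]
    rw [integral_finsetSum _ fun j _ => (hint _ (by fun_prop)).const_mul _,
      Finset.sum_range_succ, Finset.sum_eq_zero]
    · rw [integral_const_mul]; simp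
    · intro j hj
      rw [integral_const_mul, ih j (Finset.mem_range.mp hj), mul_zero]
  have hfin : ∫ x, ⟪x, u⟫ ^ k * E x = h ^ k * ∫ x, ⟪x, u⟫ ^ k * E x := by
    have hi : ∀ i, Integrable fun x => ⟪x, u⟫ ^ k * E (h⁻¹ • (x - w i)) := by
      intro i
      have := ((hint (fun x => ⟪h • x + w i, u⟫ ^ k) (by fun_prop)).comp_smul
        (inv_ne_zero h0.ne')).comp_sub_right (w i)
      simpa [smul_smul, h0.ne'] using this
    calc ∫ x, ⟪x, u⟫ ^ k * E x
        = ∫ x, ∑ i, a i * (⟪x, u⟫ ^ k * E (h⁻¹ • (x - w i))) := by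
          refine integral_congr_ae ?_
          filter_upwards [href] with x hx
          rw [hx, Finset.mul_sum]
          exact Finset.sum_congr rfl fun i _ => by ring
      _ = ∑ i, a i * (h ^ n * (h ^ k * ∫ x, ⟪x, u⟫ ^ k * E x)) := by
          rw [integral_finsetSum _ fun i _ => (hi i).const_mul _]
          exact Finset.sum_congr rfl fun i _ => by rw [integral_const_mul, key]
      _ = ((∑ i, a i) * h ^ n) * (h ^ k * ∫ x, ⟪x, u⟫ ^ k * E x) := by
          rw [← Finset.sum_mul]; ring
      _ = _ := by rw [ha, one_mul]
  have hlt : h ^ k < 1 := pow_lt_one₀ h0.le h1 hk.ne'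
  have : (1 - h ^ k) * ∫ x, ⟪x, u⟫ ^ k * E x = 0 := by linarith
  exact (mul_eq_zero.mp this).resolve_left (by linarith)

/-! ### Almost everywhere local constancy on the real line -/

open Filter Topology in
/-- `f` is almost everywhere constant near `r`. -/
def AEConstNear (f : ℝ → ℝ) (r : ℝ) : Prop :=
  ∃ κ, ∀ᶠ s in ae volume ⊓ 𝓝 r, f s = κ

namespace AEConstNear

open Filter Topology

theorem sum {ι : Type*} {I : Finset ι} {f : ι → ℝ → ℝ} {r : ℝ}
    (hf : ∀ i ∈ I, AEConstNear (f i) r) : AEConstNear (fun s => ∑ i ∈ I, f i s) r := by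
  choose! κ hκ using hf
  refine ⟨∑ i ∈ I, κ i, ?_⟩
  filter_upwards [(Filter.eventually_all_finset I).mpr hκ] with s hs
  exact Finset.sum_congr rfl hs

theorem const_mul {f : ℝ → ℝ} {r : ℝ} (hf : AEConstNear f r) (a : ℝ) :
    AEConstNear (fun s => a * f s) r := by
  obtain ⟨κ, hκ⟩ := hf
  exact ⟨a * κ, hκ.mono fun s hs => by simp only [hs]⟩

theorem sub {f g : ℝ → ℝ} {r : ℝ} (hf : AEConstNear f r) (hg : AEConstNear g r) :
    AEConstNear (fun s => f s - g s) r := by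
  obtain ⟨κ, hκ⟩ := hf
  obtain ⟨τ, hτ⟩ := hg
  refine ⟨κ - τ, ?_⟩
  filter_upwards [hκ, hτ] with s h1 h2
  rw [h1, h2]

theorem congr_ae {f g : ℝ → ℝ} {r : ℝ} (hf : AEConstNear f r) (hfg : f =ᵐ[volume] g) :
    AEConstNear g r := by
  obtain ⟨κ, hκ⟩ := hf
  refine ⟨κ, ?_⟩
  filter_upwards [hκ, hfg.filter_mono inf_le_left] with s h1 h2
  rw [← h2, h1]

theorem of_eventually {f : ℝ → ℝ} {r κ : ℝ} (hf : ∀ᶠ s in 𝓝[≠] r, f s = κ) :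
    AEConstNear f r := by
  refine ⟨κ, ?_⟩
  rw [eventually_nhdsWithin_iff] at hf
  have h2 : ∀ᵐ s : ℝ, s ≠ r := by simp [ae_iff]
  filter_upwards [hf.filter_mono inf_le_right, h2.filter_mono inf_le_left] with s h1 h2
  exact h1 h2

theorem comp_mul {f : ℝ → ℝ} {r a : ℝ} (ha : a ≠ 0) (hf : AEConstNear f (a * r)) :
    AEConstNear (fun s => f (a * s)) r := by
  obtain ⟨κ, hκ⟩ := hf
  refine ⟨κ, ?_⟩
  have h1 : Tendsto (fun s : ℝ => a * s) (ae volume) (ae volume) :=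
    (Measure.quasiMeasurePreserving_smul volume ha).tendsto_ae
  have h2 : Tendsto (fun s : ℝ => a * s) (𝓝 r) (𝓝 (a * r)) :=
    (continuous_const.mul continuous_id).tendsto r
  exact (h1.inf h2).eventually hκ

theorem neBot (r : ℝ) : (ae (volume : Measure ℝ) ⊓ 𝓝 r).NeBot := by
  rw [inf_neBot_iff]
  intro s hs t ht
  by_contra hne
  have hsub : t ⊆ sᶜ := fun x hx hxs => hne ⟨x, hxs, hx⟩
  exact (Measure.measure_pos_of_mem_nhds volume ht).ne' (measure_mono_null hsub hs)

/-- A function that is a.e. constant on one side and on the other side of `r` and a.e. constant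
near `r` has equal one-sided values. -/
theorem eq_of_sides {f : ℝ → ℝ} {r κ τ : ℝ} (hf : AEConstNear f r)
    (h1 : ∀ᶠ s in 𝓝[>] r, f s = κ) (h2 : ∀ᶠ s in 𝓝[<] r, f s = τ) : κ = τ := by
  obtain ⟨σ, hσ⟩ := hf
  rw [Filter.eventually_inf] at hσ
  obtain ⟨A, hA, U, hU, hAU⟩ := hσ
  have key : ∀ (V : Set ℝ) (ρ : ℝ), (∀ᶠ s in 𝓝[V] r, f s = ρ) →
      (∀ W ∈ 𝓝[V] r, 0 < volume W) → ρ = σ := by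
    intro V ρ h hpos
    have hW : U ∩ {s | f s = ρ} ∈ 𝓝[V] r := inter_mem (mem_nhdsWithin_of_mem_nhds hU) h
    by_contra hne
    have hsub : U ∩ {s | f s = ρ} ⊆ Aᶜ := fun x hx hxA =>
      hne (hx.2.symm.trans (hAU x ⟨hxA, hx.1⟩))
    exact (hpos _ hW).ne' (measure_mono_null hsub hA)
  rw [key (Ioi r) κ h1, key (Iio r) τ h2]
  · intro W hW
    obtain ⟨l, hl, hlW⟩ := mem_nhdsLT_iff_exists_Ioo_subset.mp hW
    refine lt_of_lt_of_le ?_ (measure_mono hlW)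
    simpa using hl
  · intro W hW
    obtain ⟨l, hl, hlW⟩ := mem_nhdsGT_iff_exists_Ioo_subset.mp hW
    refine lt_of_lt_of_le ?_ (measure_mono hlW)
    simpa using hl

/-- Local values at nearby points agree because no neighbourhood is null, so the local value is a
locally constant function on a connected line. -/
theorem ae_eq_const {f : ℝ → ℝ} (hf : ∀ r, AEConstNear f r) : ∃ κ, f =ᵐ[volume] fun _ => κ := by
  choose κ hκ using hf
  have hloc : IsLocallyConstant κ := by
    rw [IsLocallyConstant.iff_eventually_eq]
    intro r
    obtain ⟨A, hA, U, hU, hAU⟩ := Filter.eventually_inf.mp (hκ r)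
    filter_upwards [eventually_eventually_nhds.mpr hU] with r' hr'
    have h3 : ∀ᶠ s in ae volume ⊓ 𝓝 r', f s = κ r := by
      filter_upwards [mem_inf_of_left hA, mem_inf_of_right hr'] with s h1 h2
      exact hAU s ⟨h1, h2⟩
    obtain ⟨s, h4, h5⟩ := haveI := neBot r'; ((hκ r').and h3).exists
    exact h4.symm.trans h5
  refine ⟨κ 0, ?_⟩
  have hc : ∀ r, κ r = κ 0 := fun r => hloc.apply_eq_of_preconnectedSpace r 0
  refine measure_null_of_locally_null _ fun r _ => ?_
  obtain ⟨A, hA, U, hU, hAU⟩ := Filter.eventually_inf.mp (hκ r)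
  refine ⟨_, inter_mem_nhdsWithin _ hU, measure_mono_null ?_ hA⟩
  intro s hs hsA
  exact hs.1 ((hAU s ⟨hsA, hs.2⟩).trans (hc r))

end AEConstNear

/-! ### Jumps along lines of a fixed direction -/

open Filter

/-- Lines are parametrised redundantly, by all `y` in space, so Fubini and translation invariance
suffice and no orthogonal splitting is needed. -/
theorem ae_ae_line_of_ae {n : ℕ} (ν : Sp n) {p : Sp n → Prop} (hp : ∀ᵐ x, p x) :
    ∀ᵐ y : Sp n, ∀ᵐ s : ℝ, p (y + s • ν) := by
  obtain ⟨N, hN, hNm, hN0⟩ := exists_measurable_superset_of_null hp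
  have hmeas : MeasurableSet {z : ℝ × Sp n | z.2 + z.1 • ν ∉ N} :=
    (by fun_prop : Measurable fun z : ℝ × Sp n => z.2 + z.1 • ν) hNm.compl
  have h1 : ∀ᵐ s : ℝ, ∀ᵐ y : Sp n, y + s • ν ∉ N := by
    refine Eventually.of_forall fun s => ?_
    exact (measurePreserving_add_right volume (s • ν)).quasiMeasurePreserving.ae
      (measure_eq_zero_iff_ae_notMem.mp hN0)
  rw [Measure.ae_ae_comm hmeas] at h1
  filter_upwards [h1] with y hy
  filter_upwards [hy] with s hs
  by_contra hps
  exact hs (hN hps)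

theorem ae_of_ae_ae_line {n : ℕ} (ν : Sp n) {p : Sp n → Prop} (hm : MeasurableSet {x | p x})
    (hp : ∀ᵐ y : Sp n, ∀ᵐ s : ℝ, p (y + s • ν)) : ∀ᵐ x, p x := by
  have hmeas : MeasurableSet {z : Sp n × ℝ | p (z.1 + z.2 • ν)} :=
    (by fun_prop : Measurable fun z : Sp n × ℝ => z.1 + z.2 • ν) hm
  rw [Measure.ae_ae_comm hmeas] at hp
  obtain ⟨s, hs⟩ := hp.exists
  have := (measurePreserving_add_right volume (-(s • ν))).quasiMeasurePreserving.ae hs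
  simpa using this

theorem ae_inner_ne {n : ℕ} {a : Sp n} (ha : a ≠ 0) (r : ℝ) : ∀ᵐ x : Sp n, ⟪a, x⟫ ≠ r := by
  refine ae_of_ae_ae_line a ?_ (Eventually.of_forall fun y => ?_)
  · exact (isOpen_ne_fun (by fun_prop) continuous_const).measurableSet
  · have h2 : ∀ᵐ s : ℝ, s ≠ (r - ⟪a, y⟫) / ⟪a, a⟫ := by simp [ae_iff]
    filter_upwards [h2] with s hs h
    apply hs
    rw [inner_add_right, real_inner_smul_right] at h
    have : ⟪a, a⟫ ≠ (0 : ℝ) := inner_self_ne_zero.mpr ha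
    field_simp
    linarith

/-- On almost every line of direction `ν`, `φ` is a.e. constant near the point of height `b`. -/
def HasNoFacetJump {n : ℕ} (ν : Sp n) (φ : Sp n → ℝ) : Prop :=
  ∀ b, ∀ᵐ y, AEConstNear (fun s => φ (y + s • ν)) (b - ⟪ν, y⟫)

/-- On almost every line of direction `ν`, `φ` is a.e. locally constant off finitely many heights
that do not depend on the line. -/
def HasOnlyFacetJumps {n : ℕ} (ν : Sp n) (φ : Sp n → ℝ) : Prop :=
  ∃ B : Finset ℝ, ∀ᵐ y, ∀ b ∉ B, AEConstNear (fun s => φ (y + s • ν)) (b - ⟪ν, y⟫)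

theorem quasiMeasurePreserving_dilation {n : ℕ} {h : ℝ} (hh : h ≠ 0) (w : Sp n) :
    Measure.QuasiMeasurePreserving (fun x : Sp n => h⁻¹ • (x - w)) :=
  (Measure.quasiMeasurePreserving_smul volume (inv_ne_zero hh)).comp
    (measurePreserving_sub_right volume w).quasiMeasurePreserving

theorem AEConstNear.dilation {n : ℕ} {ν w y : Sp n} {φ : Sp n → ℝ} {h b : ℝ} (hh : h ≠ 0)
    (H : AEConstNear (fun s => φ (h⁻¹ • (y - w) + s • ν))
      (h⁻¹ * (b - ⟪ν, w⟫) - ⟪ν, h⁻¹ • (y - w)⟫)) :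
    AEConstNear (fun s => φ (h⁻¹ • (y + s • ν - w))) (b - ⟪ν, y⟫) := by
  have e : h⁻¹ * (b - ⟪ν, w⟫) - ⟪ν, h⁻¹ • (y - w)⟫ = h⁻¹ * (b - ⟪ν, y⟫) := by
    rw [real_inner_smul_right, inner_sub_right]; ring
  rw [e] at H
  have := H.comp_mul (inv_ne_zero hh)
  convert this using 3 with s
  rw [mul_smul, ← smul_add]
  congr 1
  abel

theorem HasNoFacetJump.dilation {n : ℕ} {ν : Sp n} {φ : Sp n → ℝ} (H : HasNoFacetJump ν φ) {h : ℝ}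
    (hh : h ≠ 0) (w : Sp n) : HasNoFacetJump ν fun x => φ (h⁻¹ • (x - w)) := by
  intro b
  filter_upwards [(quasiMeasurePreserving_dilation hh w).ae (H (h⁻¹ * (b - ⟪ν, w⟫)))] with y hy
  exact AEConstNear.dilation hh hy

theorem HasOnlyFacetJumps.dilation {n : ℕ} {ν : Sp n} {φ : Sp n → ℝ} (H : HasOnlyFacetJumps ν φ)
    {h : ℝ} (hh : h ≠ 0) (w : Sp n) : HasOnlyFacetJumps ν fun x => φ (h⁻¹ • (x - w)) := by
  obtain ⟨B, hB⟩ := H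
  refine ⟨B.image fun b => h * b + ⟪ν, w⟫, ?_⟩
  filter_upwards [(quasiMeasurePreserving_dilation hh w).ae hB] with y hy b hb
  refine AEConstNear.dilation hh (hy _ fun hmem => hb ?_)
  refine Finset.mem_image.mpr ⟨_, hmem, ?_⟩
  field_simp
  ring

theorem HasNoFacetJump.refine {n m : ℕ} {ν : Sp n} {φ : Sp n → ℝ} (H : HasNoFacetJump ν φ) {h : ℝ}
    (hh : h ≠ 0) (a : Fin m → ℝ) (w : Fin m → Sp n) :
    HasNoFacetJump ν fun x => φ x - ∑ i, a i * φ (h⁻¹ • (x - w i)) := by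
  intro b
  filter_upwards [H b, ae_all_iff.mpr fun i => H.dilation hh (w i) b] with y h1 h2
  exact h1.sub (AEConstNear.sum fun i _ => (h2 i).const_mul (a i))

theorem HasOnlyFacetJumps.refine {n m : ℕ} {ν : Sp n} {φ : Sp n → ℝ} (H : HasOnlyFacetJumps ν φ)
    {h : ℝ} (hh : h ≠ 0) (a : Fin m → ℝ) (w : Fin m → Sp n) :
    HasOnlyFacetJumps ν fun x => φ x - ∑ i, a i * φ (h⁻¹ • (x - w i)) := by
  classical
  choose D hD using fun i => H.dilation hh (w i)
  obtain ⟨B, hB⟩ := H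
  refine ⟨B ∪ Finset.univ.biUnion D, ?_⟩
  filter_upwards [hB, ae_all_iff.mpr hD] with y h1 h2 b hb
  simp only [Finset.mem_union, Finset.mem_biUnion, Finset.mem_univ, true_and, not_or,
    not_exists] at hb
  exact (h1 b hb.1).sub (AEConstNear.sum fun i _ => (h2 i b (hb.2 i)).const_mul (a i))

theorem HasNoFacetJump.const_mul {n : ℕ} {ν : Sp n} {φ : Sp n → ℝ} (H : HasNoFacetJump ν φ)
    (a : ℝ) : HasNoFacetJump ν fun x => a * φ x :=
  fun b => (H b).mono fun _ hy => hy.const_mul a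

theorem HasOnlyFacetJumps.const_mul {n : ℕ} {ν : Sp n} {φ : Sp n → ℝ}
    (H : HasOnlyFacetJumps ν φ) (a : ℝ) : HasOnlyFacetJumps ν fun x => a * φ x := by
  obtain ⟨B, hB⟩ := H
  exact ⟨B, hB.mono fun _ hy b hb => (hy b hb).const_mul a⟩

theorem HasNoFacetJump.congr_ae {n : ℕ} {ν : Sp n} {φ ψ : Sp n → ℝ} (H : HasNoFacetJump ν φ)
    (h : φ =ᵐ[volume] ψ) : HasNoFacetJump ν ψ := by
  intro b
  filter_upwards [H b, ae_ae_line_of_ae ν h] with y h1 h2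
  exact h1.congr_ae h2

theorem HasOnlyFacetJumps.congr_ae {n : ℕ} {ν : Sp n} {φ ψ : Sp n → ℝ} (H : HasOnlyFacetJumps ν φ)
    (h : φ =ᵐ[volume] ψ) : HasOnlyFacetJumps ν ψ := by
  obtain ⟨B, hB⟩ := H
  refine ⟨B, ?_⟩
  filter_upwards [hB, ae_ae_line_of_ae ν h] with y h1 h2 b hb
  exact (h1 b hb).congr_ae h2

/-- `HasNoFacetJump` has an exceptional null set of lines for each height, but only the finitely
many heights in `B` are needed. Thus on almost every line `φ` is a.e. constant, and the line leaves
the support. -/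
theorem HasOnlyFacetJumps.ae_eq_zero {n : ℕ} {ν : Sp n} (hν : ‖ν‖ = 1) {φ : Sp n → ℝ} {R : ℝ}
    (hm : Measurable φ) (hR : ∀ x, R < ‖x‖ → φ x = 0) (H : HasOnlyFacetJumps ν φ)
    (H' : HasNoFacetJump ν φ) : φ =ᵐ[volume] 0 := by
  obtain ⟨B, hB⟩ := H
  refine ae_of_ae_ae_line ν (hm (measurableSet_singleton 0)) ?_
  filter_upwards [hB, (Filter.eventually_all_finset B).mpr fun b _ => H' b] with y h1 h2
  have hall : ∀ r, AEConstNear (fun s => φ (y + s • ν)) r := by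
    intro r
    have e : r = (r + ⟪ν, y⟫) - ⟪ν, y⟫ := by ring
    rw [e]
    by_cases hr : r + ⟪ν, y⟫ ∈ B
    exacts [h2 _ hr, h1 _ hr]
  obtain ⟨κ, hκ⟩ := AEConstNear.ae_eq_const hall
  have hκ0 : κ = 0 := by
    by_contra hne
    have hsub : Ioi (R + ‖y‖) ⊆ {s | ¬ φ (y + s • ν) = κ} := by
      intro s hs
      have h3 : φ (y + s • ν) = 0 := by
        apply hR
        have h4 : ‖s • ν‖ ≤ ‖y + s • ν‖ + ‖y‖ := by
          simpa using norm_sub_le (y + s • ν) y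
        rw [norm_smul, hν, mul_one, Real.norm_eq_abs] at h4
        have := le_abs_self s
        have : R + ‖y‖ < s := hs
        linarith
      simpa [h3] using Ne.symm hne
    have h0 := measure_mono_null hsub hκ
    simp at h0
  filter_upwards [hκ] with s hs
  rw [hs, hκ0]; rfl

/-! ### The facet part of an indicator function -/

open Topology in
theorem exists_indicator_eq_of_notMem_frontier {n : ℕ} {c : Set (Sp n)} {ν y : Sp n} {I : Set ℝ}
    (hI : IsPreconnected I) (hf : ∀ s ∈ I, y + s • ν ∉ frontier c) :
    ∃ κ : ℝ, ∀ s ∈ I, c.indicator (fun _ => (1 : ℝ)) (y + s • ν) = κ := by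
  have himg : IsPreconnected ((fun s : ℝ => y + s • ν) '' I) :=
    hI.image _ (by fun_prop)
  by_cases hne : ((fun s : ℝ => y + s • ν) '' I ∩ c).Nonempty
  · refine ⟨1, fun s hs => indicator_of_mem ?_ _⟩
    by_contra hsc
    have hin : ∀ t ∈ I, y + t • ν ∈ c → y + t • ν ∈ interior c := fun t ht h => by
      by_contra hi
      exact hf t ht ⟨subset_closure h, hi⟩
    have hout : ∀ t ∈ I, y + t • ν ∉ c → y + t • ν ∉ closure c := fun t ht h hcl =>
      hf t ht ⟨hcl, fun hi => h (interior_subset hi)⟩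
    obtain ⟨_, ⟨t, ht, rfl⟩, htc⟩ := hne
    obtain ⟨x, -, hx1, hx2⟩ := himg _ _ isOpen_interior isClosed_closure.isOpen_compl
      (by
        rintro _ ⟨t, ht, rfl⟩
        by_cases h : y + t • ν ∈ c
        exacts [.inl (hin t ht h), .inr (hout t ht h)])
      ⟨_, mem_image_of_mem _ ht, hin t ht htc⟩ ⟨_, mem_image_of_mem _ hs, hout s hs hsc⟩
    exact hx2 (subset_closure (interior_subset hx1))
  · refine ⟨0, fun s hs => indicator_of_notMem (fun hsc => hne ⟨_, mem_image_of_mem _ hs, hsc⟩) _⟩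

open Topology in
theorem exists_eventually_indicator_eq_right {n : ℕ} {c : Set (Sp n)} {ν y : Sp n} {r : ℝ}
    (hf : ∀ᶠ s in 𝓝[>] r, y + s • ν ∉ frontier c) :
    ∃ κ : ℝ, ∀ᶠ s in 𝓝[>] r, c.indicator (fun _ => (1 : ℝ)) (y + s • ν) = κ := by
  obtain ⟨u, hu, hsub⟩ := mem_nhdsGT_iff_exists_Ioo_subset.mp hf
  obtain ⟨κ, hκ⟩ := exists_indicator_eq_of_notMem_frontier isPreconnected_Ioo fun s hs => hsub hs
  exact ⟨κ, mem_of_superset (Ioo_mem_nhdsGT hu) hκ⟩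

open Topology in
theorem exists_eventually_indicator_eq_left {n : ℕ} {c : Set (Sp n)} {ν y : Sp n} {r : ℝ}
    (hf : ∀ᶠ s in 𝓝[<] r, y + s • ν ∉ frontier c) :
    ∃ κ : ℝ, ∀ᶠ s in 𝓝[<] r, c.indicator (fun _ => (1 : ℝ)) (y + s • ν) = κ := by
  obtain ⟨u, hu, hsub⟩ := mem_nhdsLT_iff_exists_Ioo_subset.mp hf
  obtain ⟨κ, hκ⟩ := exists_indicator_eq_of_notMem_frontier isPreconnected_Ioo fun s hs => hsub hs
  exact ⟨κ, mem_of_superset (Ioo_mem_nhdsLT hu) hκ⟩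

/-- The points on whose line of direction `ν` the set `c` contains the points just above
height `b`. -/
def aboveSet {n : ℕ} (c : Set (Sp n)) (ν : Sp n) (b : ℝ) : Set (Sp n) :=
  {y | ∀ᶠ k : ℕ in atTop, y + (b - ⟪ν, y⟫ + ((k : ℝ) + 1)⁻¹) • ν ∈ c}

/-- The points on whose line of direction `ν` the set `c` contains the points just below
height `b`. -/
def belowSet {n : ℕ} (c : Set (Sp n)) (ν : Sp n) (b : ℝ) : Set (Sp n) :=
  {y | ∀ᶠ k : ℕ in atTop, y + (b - ⟪ν, y⟫ - ((k : ℝ) + 1)⁻¹) • ν ∈ c}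

/-- The jump of the indicator function of `c` at height `b` on the line of direction `ν`
through `y`. -/
noncomputable def facetJump {n : ℕ} (c : Set (Sp n)) (ν : Sp n) (b : ℝ) (y : Sp n) : ℝ :=
  (aboveSet c ν b).indicator (fun _ => (1 : ℝ)) y - (belowSet c ν b).indicator (fun _ => (1 : ℝ)) y

/-- The sum of the jumps at the heights in `B` below `y`. -/
noncomputable def facetPart {n : ℕ} (c : Set (Sp n)) (ν : Sp n) (B : Finset ℝ) (y : Sp n) : ℝ :=
  ∑ b ∈ B, if b < ⟪ν, y⟫ then facetJump c ν b y else 0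

theorem facetJump_add_smul {n : ℕ} (c : Set (Sp n)) {ν : Sp n} (hν : ‖ν‖ = 1) (b : ℝ) (y : Sp n)
    (s : ℝ) : facetJump c ν b (y + s • ν) = facetJump c ν b y := by
  classical
  have key : ∀ t : ℝ, y + s • ν + (b - ⟪ν, y + s • ν⟫ + t) • ν = y + (b - ⟪ν, y⟫ + t) • ν := by
    intro t
    rw [inner_add_right, real_inner_smul_right, real_inner_self_eq_norm_sq, hν]
    module
  have e1 : y + s • ν ∈ aboveSet c ν b ↔ y ∈ aboveSet c ν b := by
    simp only [aboveSet, mem_ofPred_eq, key]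
  have e2 : y + s • ν ∈ belowSet c ν b ↔ y ∈ belowSet c ν b := by
    simp only [belowSet, mem_ofPred_eq, sub_eq_add_neg (_ - _), key]
  simp only [facetJump, indicator_apply, e1, e2]

theorem abs_facetJump_le {n : ℕ} (c : Set (Sp n)) (ν : Sp n) (b : ℝ) (y : Sp n) :
    |facetJump c ν b y| ≤ 1 := by
  classical
  simp only [facetJump, indicator_apply]
  split_ifs <;> simp

theorem abs_facetPart_le {n : ℕ} (c : Set (Sp n)) (ν : Sp n) (B : Finset ℝ) (y : Sp n) :
    |facetPart c ν B y| ≤ B.card := by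
  refine (Finset.abs_sum_le_sum_abs _ _).trans ?_
  refine (Finset.sum_le_card_nsmul _ _ 1 fun b _ => ?_).trans (by simp)
  split_ifs
  · exact abs_facetJump_le c ν b y
  · simp

/-- One-sided values are tested along the sequence `1 / (k + 1)`, so that only countable unions and
intersections occur. -/
theorem measurable_facetJump {n : ℕ} {c : Set (Sp n)} (hc : MeasurableSet c) (ν : Sp n) (b : ℝ) :
    Measurable (facetJump c ν b) := by
  have key : ∀ g : ℕ → ℝ,
      MeasurableSet {y : Sp n | ∀ᶠ k : ℕ in atTop, y + (b - ⟪ν, y⟫ + g k) • ν ∈ c} := by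
    intro g
    have : {y : Sp n | ∀ᶠ k : ℕ in atTop, y + (b - ⟪ν, y⟫ + g k) • ν ∈ c}
        = ⋃ N : ℕ, ⋂ k : ℕ, ⋂ _ : N ≤ k, {y | y + (b - ⟪ν, y⟫ + g k) • ν ∈ c} := by
      ext y; simp [eventually_atTop]
    rw [this]
    exact .iUnion fun N => .iInter fun k => .iInter fun _ =>
      (by fun_prop : Measurable fun y : Sp n => y + (b - ⟪ν, y⟫ + g k) • ν) hc
  refine (measurable_const.indicator (key _)).sub (measurable_const.indicator ?_)
  simpa only [belowSet, ← sub_eq_add_neg] using key fun k => -((k : ℝ) + 1)⁻¹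

theorem measurable_facetPart {n : ℕ} {c : Set (Sp n)} (hc : MeasurableSet c) (ν : Sp n)
    (B : Finset ℝ) : Measurable (facetPart c ν B) := by
  refine Finset.measurable_fun_sum _ fun b _ => Measurable.ite ?_ (measurable_facetJump hc ν b)
    measurable_const
  exact measurableSet_lt measurable_const (by fun_prop)

open Topology in
theorem facetJump_eq_sub {n : ℕ} {c : Set (Sp n)} {ν y : Sp n} {b κ τ : ℝ}
    (h1 : ∀ᶠ s in 𝓝[>] (b - ⟪ν, y⟫), c.indicator (fun _ => (1 : ℝ)) (y + s • ν) = κ)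
    (h2 : ∀ᶠ s in 𝓝[<] (b - ⟪ν, y⟫), c.indicator (fun _ => (1 : ℝ)) (y + s • ν) = τ) :
    facetJump c ν b y = κ - τ := by
  have key : ∀ (g : ℕ → ℝ) (ρ : ℝ),
      (∀ᶠ k in atTop, c.indicator (fun _ => (1 : ℝ)) (y + g k • ν) = ρ) →
      {y' : Sp n | ∀ᶠ k in atTop, y + g k • ν ∈ c}.indicator (fun _ => (1 : ℝ)) y = ρ := by
    intro g ρ h
    by_cases hy : ∀ᶠ k in atTop, y + g k • ν ∈ c
    · obtain ⟨k, hk1, hk2⟩ := (hy.and h).exists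
      rw [indicator_of_mem hk1] at hk2
      rw [indicator_of_mem (by exact hy), hk2]
    · obtain ⟨k, hk1, hk2⟩ := ((not_eventually.mp hy).and_eventually h).exists
      rw [indicator_of_notMem hk1] at hk2
      rw [indicator_of_notMem (by exact hy), hk2]
  have hlim : Tendsto (fun k : ℕ => ((k : ℝ) + 1)⁻¹) atTop (𝓝 0) := by
    simpa [one_div] using tendsto_one_div_add_atTop_nhds_zero_nat (𝕜 := ℝ)
  have hpos : ∀ k : ℕ, 0 < ((k : ℝ) + 1)⁻¹ := fun k => by positivity
  have t1 : Tendsto (fun k : ℕ => b - ⟪ν, y⟫ + ((k : ℝ) + 1)⁻¹) atTop (𝓝[>] (b - ⟪ν, y⟫)) := by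
    refine tendsto_nhdsWithin_iff.mpr ⟨by simpa using hlim.const_add (b - ⟪ν, y⟫),
      Eventually.of_forall fun k => ?_⟩
    simpa using hpos k
  have t2 : Tendsto (fun k : ℕ => b - ⟪ν, y⟫ - ((k : ℝ) + 1)⁻¹) atTop (𝓝[<] (b - ⟪ν, y⟫)) := by
    refine tendsto_nhdsWithin_iff.mpr ⟨by simpa using hlim.const_sub (b - ⟪ν, y⟫),
      Eventually.of_forall fun k => ?_⟩
    simpa using hpos k
  have k1 := key _ κ (t1.eventually h1)
  have k2 := key _ τ (t2.eventually h2)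
  have hJ : facetJump c ν b y = {y' : Sp n | ∀ᶠ k : ℕ in atTop,
      y + (b - ⟪ν, y⟫ + ((k : ℝ) + 1)⁻¹) • ν ∈ c}.indicator (fun _ => (1 : ℝ)) y -
      {y' : Sp n | ∀ᶠ k : ℕ in atTop,
      y + (b - ⟪ν, y⟫ - ((k : ℝ) + 1)⁻¹) • ν ∈ c}.indicator (fun _ => (1 : ℝ)) y := by
    classical
    simp only [facetJump, aboveSet, belowSet, indicator_apply, mem_ofPred_eq]
  rw [hJ, k1, k2]

open Topology in
/-- Almost every line of direction `ν` meets a polyhedral boundary in isolated points only. -/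
theorem ae_eventually_notMem_frontier {n : ℕ} {c : Set (Sp n)} (ν : Sp n)
    {H : Finset (Sp n × ℝ)} (hH0 : ∀ p ∈ H, p.1 ≠ 0)
    (hH : ∀ x ∈ frontier c, ∃ p ∈ H, ⟪p.1, x⟫ = p.2) :
    ∀ᵐ y : Sp n, ∀ r : ℝ, ∀ᶠ s in 𝓝[≠] r, y + s • ν ∉ frontier c := by
  filter_upwards [(Filter.eventually_all_finset H).mpr fun p hp => ae_inner_ne (hH0 p hp) p.2]
    with y hy r
  have hfin : {s : ℝ | y + s • ν ∈ frontier c}.Finite := by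
    refine (H.image fun p => (p.2 - ⟪p.1, y⟫) / ⟪p.1, ν⟫).finite_toSet.subset fun s hs => ?_
    obtain ⟨p, hp, hps⟩ := hH _ hs
    rw [inner_add_right, real_inner_smul_right] at hps
    have hne : ⟪p.1, ν⟫ ≠ (0 : ℝ) := by
      intro h0
      rw [h0] at hps
      exact hy p hp (by linarith)
    refine Finset.mem_coe.mpr (Finset.mem_image.mpr ⟨p, hp, ?_⟩)
    field_simp
    linarith
  have hcl := (hfin.subset (sdiff_subset (t := {r}))).isClosed
  have := hcl.isOpen_compl.mem_nhds (x := r) (by simp)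
  rw [eventually_nhdsWithin_iff]
  filter_upwards [this] with s hs hsr hsf
  exact hs ⟨hsf, hsr⟩

open Topology in
theorem aeConstNear_facetTerm {n : ℕ} (c : Set (Sp n)) {ν : Sp n} (hν : ‖ν‖ = 1) (y : Sp n)
    {b b' : ℝ} (hb : b ≠ b') :
    AEConstNear (fun s => if b < ⟪ν, y + s • ν⟫ then facetJump c ν b (y + s • ν) else 0)
      (b' - ⟪ν, y⟫) := by
  refine .of_eventually (κ := if b < b' then facetJump c ν b y else 0)
    (Eventually.filter_mono nhdsWithin_le_nhds ?_)
  have e : ∀ s : ℝ, ⟪ν, y + s • ν⟫ = ⟪ν, y⟫ + s := by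
    intro s
    rw [inner_add_right, real_inner_smul_right, real_inner_self_eq_norm_sq, hν]
    ring
  simp only [facetJump_add_smul c hν, e]
  rcases lt_or_gt_of_ne hb with h | h
  · filter_upwards [Ioi_mem_nhds (show b - ⟪ν, y⟫ < b' - ⟪ν, y⟫ by linarith)] with s hs
    have : b - ⟪ν, y⟫ < s := hs
    rw [if_pos h, if_pos (by linarith)]
  · filter_upwards [Iio_mem_nhds (show b' - ⟪ν, y⟫ < b - ⟪ν, y⟫ by linarith)] with s hs
    have : s < b - ⟪ν, y⟫ := hs
    rw [if_neg h.le.not_gt, if_neg (by linarith)]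

theorem hasOnlyFacetJumps_facetPart {n : ℕ} (c : Set (Sp n)) {ν : Sp n} (hν : ‖ν‖ = 1)
    (B : Finset ℝ) : HasOnlyFacetJumps ν (facetPart c ν B) := by
  refine ⟨B, Eventually.of_forall fun y b' hb' => AEConstNear.sum fun b hb => ?_⟩
  exact aeConstNear_facetTerm c hν y fun h => hb' (h ▸ hb)

open Topology in
-- A bounding hyperplane catches the point at height `b` for a non-null set of `y` only if it is the
-- hyperplane of that height itself, which `hb` excludes.
theorem ae_notMem_frontier_at_height {n : ℕ} {c : Set (Sp n)} {ν : Sp n}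
    {H : Finset (Sp n × ℝ)} (hH0 : ∀ p ∈ H, p.1 ≠ 0)
    (hH : ∀ x ∈ frontier c, ∃ p ∈ H, ⟪p.1, x⟫ = p.2) {b : ℝ}
    (hb : ∀ p ∈ H, b ≠ p.2 / ⟪p.1, ν⟫) :
    ∀ᵐ y : Sp n, y + (b - ⟪ν, y⟫) • ν ∉ frontier c := by
  have : ∀ p ∈ H, ∀ᵐ y : Sp n, ⟪p.1, y + (b - ⟪ν, y⟫) • ν⟫ ≠ p.2 := by
    intro p hp
    have e : ∀ y : Sp n, ⟪p.1, y + (b - ⟪ν, y⟫) • ν⟫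
        = ⟪p.1 - ⟪p.1, ν⟫ • ν, y⟫ + b * ⟪p.1, ν⟫ := by
      intro y
      rw [inner_add_right, real_inner_smul_right, inner_sub_left, real_inner_smul_left]
      ring
    simp only [e]
    by_cases ha : p.1 - ⟪p.1, ν⟫ • ν = 0
    · refine Eventually.of_forall fun y hy => hb p hp ?_
      have hne : ⟪p.1, ν⟫ ≠ (0 : ℝ) := by
        intro h0
        rw [h0, zero_smul, sub_zero] at ha
        exact hH0 p hp ha
      rw [ha, inner_zero_left, zero_add] at hy
      rw [eq_div_iff hne, hy]
    · filter_upwards [ae_inner_ne ha (p.2 - b * ⟪p.1, ν⟫)] with y hy h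
      exact hy (by linarith)
  filter_upwards [(Filter.eventually_all_finset H).mpr this] with y hy hyf
  obtain ⟨p, hp, hpe⟩ := hH _ hyf
  exact hy p hp hpe

open Topology in
-- At a height in `B` the corresponding step of `facetPart` cancels the jump of the indicator; at
-- any other height almost every line misses the boundary.
theorem hasNoFacetJump_sub_facetPart {n : ℕ} {c : Set (Sp n)} {ν : Sp n} (hν : ‖ν‖ = 1)
    {H : Finset (Sp n × ℝ)} (hH0 : ∀ p ∈ H, p.1 ≠ 0)
    (hH : ∀ x ∈ frontier c, ∃ p ∈ H, ⟪p.1, x⟫ = p.2) {B : Finset ℝ}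
    (hB : ∀ p ∈ H, p.2 / ⟪p.1, ν⟫ ∈ B) :
    HasNoFacetJump ν fun x => c.indicator (fun _ => (1 : ℝ)) x - facetPart c ν B x := by
  intro b
  by_cases hb : b ∈ B
  · filter_upwards [ae_eventually_notMem_frontier ν hH0 hH] with y hy
    obtain ⟨κ, hκ⟩ := exists_eventually_indicator_eq_right
      ((hy (b - ⟪ν, y⟫)).filter_mono (nhdsWithin_mono _ fun s hs => ne_of_gt hs))
    obtain ⟨τ, hτ⟩ := exists_eventually_indicator_eq_left
      ((hy (b - ⟪ν, y⟫)).filter_mono (nhdsWithin_mono _ fun s hs => ne_of_lt hs))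
    have hJ := facetJump_eq_sub hκ hτ
    have e : ∀ s : ℝ, ⟪ν, y + s • ν⟫ = ⟪ν, y⟫ + s := by
      intro s
      rw [inner_add_right, real_inner_smul_right, real_inner_self_eq_norm_sq, hν]
      ring
    have h1 : AEConstNear (fun s => c.indicator (fun _ => (1 : ℝ)) (y + s • ν) -
        if b < ⟪ν, y + s • ν⟫ then facetJump c ν b (y + s • ν) else 0) (b - ⟪ν, y⟫) := by
      refine .of_eventually (κ := τ) ?_
      simp only [e, facetJump_add_smul c hν, hJ]
      rw [← nhdsLT_sup_nhdsGT, eventually_sup]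
      constructor
      · filter_upwards [hτ, self_mem_nhdsWithin] with s hs hlt
        have : s < b - ⟪ν, y⟫ := hlt
        rw [hs, if_neg (by linarith), sub_zero]
      · filter_upwards [hκ, self_mem_nhdsWithin] with s hs hlt
        have : b - ⟪ν, y⟫ < s := hlt
        rw [hs, if_pos (by linarith)]
        ring
    have h2 := AEConstNear.sum (I := B.erase b) (r := b - ⟪ν, y⟫) fun b' hb' =>
      aeConstNear_facetTerm c hν y (Finset.ne_of_mem_erase hb')
    convert! h1.sub h2 using 2 with s
    rw [facetPart, ← Finset.add_sum_erase _ _ hb]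
    ring
  · filter_upwards [ae_notMem_frontier_at_height (ν := ν) hH0 hH
      fun p hp (h : b = p.2 / ⟪p.1, ν⟫) => hb (h ▸ hB p hp)] with y hy
    have hopen : IsOpen {s : ℝ | y + s • ν ∉ frontier c} :=
      (isClosed_frontier.preimage (by fun_prop : Continuous fun s : ℝ => y + s • ν)).isOpen_compl
    obtain ⟨δ, hδ, hsub⟩ := Metric.isOpen_iff.mp hopen _ hy
    rw [Real.ball_eq_Ioo] at hsub
    obtain ⟨κ, hκ⟩ := exists_indicator_eq_of_notMem_frontier isPreconnected_Ioo hsub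
    have h1 : AEConstNear (fun s => c.indicator (fun _ => (1 : ℝ)) (y + s • ν)) (b - ⟪ν, y⟫) := by
      refine .of_eventually (κ := κ) (Eventually.filter_mono nhdsWithin_le_nhds ?_)
      exact mem_of_superset (Ioo_mem_nhds (by linarith) (by linarith)) hκ
    exact h1.sub (AEConstNear.sum fun b' hb' =>
      aeConstNear_facetTerm c hν y fun h => hb (h ▸ hb'))

/-! ### Consequences of reflection symmetry -/

/-- The reflection in `hsym` preserves each line of direction `ν` and sends height `b` to `κ - b`,
exchanging above and below. -/
theorem facetJump_reflect {n : ℕ} {c : Set (Sp n)} {ν : Sp n} (hν : ‖ν‖ = 1) {κ : ℝ}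
    (hsym : ∀ x ∈ c, x + (κ - 2 * ⟪ν, x⟫) • ν ∈ c) (b : ℝ) (y : Sp n) :
    facetJump c ν (κ - b) y = -facetJump c ν b y := by
  classical
  have key : ∀ b t : ℝ, y + (κ - b - ⟪ν, y⟫ + t) • ν ∈ c → y + (b - ⟪ν, y⟫ - t) • ν ∈ c := by
    intro b t h
    have h2 := hsym _ h
    rw [inner_add_right, real_inner_smul_right, real_inner_self_eq_norm_sq, hν] at h2
    convert h2 using 1
    module
  have e1 : ∀ t : ℝ, y + (κ - b - ⟪ν, y⟫ + t) • ν ∈ c ↔ y + (b - ⟪ν, y⟫ - t) • ν ∈ c := by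
    refine fun t => ⟨key b t, fun h => ?_⟩
    have := key (κ - b) (-t) (by convert h using 1; module)
    simpa using this
  have e2 : ∀ t : ℝ, y + (κ - b - ⟪ν, y⟫ - t) • ν ∈ c ↔ y + (b - ⟪ν, y⟫ + t) • ν ∈ c := by
    intro t
    simpa [sub_eq_add_neg] using e1 (-t)
  simp only [facetJump, aboveSet, belowSet, indicator_apply, mem_ofPred_eq, e1, e2, neg_sub]

theorem sum_facetJump_eq_zero {n : ℕ} {c : Set (Sp n)} {ν : Sp n} (hν : ‖ν‖ = 1) {κ : ℝ}
    (hsym : ∀ x ∈ c, x + (κ - 2 * ⟪ν, x⟫) • ν ∈ c) {B : Finset ℝ} (hB : ∀ b ∈ B, κ - b ∈ B)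
    (y : Sp n) : ∑ b ∈ B, facetJump c ν b y = 0 := by
  have : ∑ b ∈ B, facetJump c ν b y = ∑ b ∈ B, -facetJump c ν b y := by
    refine Finset.sum_nbij' (fun b => κ - b) (fun b => κ - b) hB hB (by simp) (by simp) ?_
    intro b _
    rw [facetJump_reflect hν hsym, neg_neg]
  rw [Finset.sum_neg_distrib] at this
  linarith

/-- Below all heights the sum is empty, above them it is the total jump, which vanishes by symmetry,
and on lines that miss `c` every jump is zero. Without the symmetry, `facetPart` could be nonzero
along a whole half-line. -/
theorem facetPart_eq_zero_of_norm_gt {n : ℕ} {c : Set (Sp n)} {ν : Sp n} (hν : ‖ν‖ = 1) {κ : ℝ}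
    (hsym : ∀ x ∈ c, x + (κ - 2 * ⟪ν, x⟫) • ν ∈ c) {B : Finset ℝ} (hB : ∀ b ∈ B, κ - b ∈ B)
    {R M : ℝ} (hR : ∀ x ∈ c, ‖x‖ ≤ R) (hM : ∀ b ∈ B, |b| ≤ M) {y : Sp n} (hy : 2 * R + M < ‖y‖) :
    facetPart c ν B y = 0 := by
  by_contra hne
  have hJ : ∃ b ∈ B, facetJump c ν b y ≠ 0 := by
    by_contra! hall
    refine hne (Finset.sum_eq_zero fun b hb => ?_)
    rw [hall b hb, ite_self]
  obtain ⟨b, hb, hJb⟩ := hJ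
  have hx : ∃ t : ℝ, y + t • ν ∈ c := by
    by_contra! hall
    refine hJb ?_
    classical
    simp only [facetJump, aboveSet, belowSet, indicator_apply, mem_ofPred_eq, hall]
    simp
  obtain ⟨t, ht⟩ := hx
  have h1 : |⟪ν, y + t • ν⟫| ≤ R := by
    have := abs_real_inner_le_norm ν (y + t • ν)
    rw [hν, one_mul] at this
    exact this.trans (hR _ ht)
  have h2 : |⟪ν, y⟫| ≤ M := by
    rw [abs_le]
    constructor
    · by_contra! hlt
      refine hne (Finset.sum_eq_zero fun b hb => if_neg ?_)
      have := (abs_le.mp (hM b hb)).1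
      linarith
    · by_contra! hlt
      refine hne ?_
      rw [← sum_facetJump_eq_zero hν hsym hB y]
      refine Finset.sum_congr rfl fun b hb => if_pos ?_
      have := (abs_le.mp (hM b hb)).2
      linarith
  have h3 : |t| ≤ R + M := by
    have e : t = ⟪ν, y + t • ν⟫ - ⟪ν, y⟫ := by
      rw [inner_add_right, real_inner_smul_right, real_inner_self_eq_norm_sq, hν]
      ring
    rw [e]
    exact (abs_sub _ _).trans (add_le_add h1 h2)
  have h4 : ‖y‖ ≤ ‖y + t • ν‖ + |t| := by
    have := norm_sub_le (y + t • ν) (t • ν)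
    rwa [add_sub_cancel_right, norm_smul, hν, mul_one, Real.norm_eq_abs] at this
  have := hR _ ht
  linarith

/-- Reflection followed by translation by `-v` maps `c` into itself. Its square is a translation
orthogonal to `ν`, which must be trivial since its iterates keep a point in a bounded set. -/
theorem exists_symmetry_of_reflectAcross {n : ℕ} {c : Set (Sp n)} (hc : Bornology.IsBounded c)
    (hne : c.Nonempty) {ν q v : Sp n} (hν : ‖ν‖ = 1)
    (h : reflectAcross ν q '' c = (fun x => x + v) '' c) :
    ∃ κ : ℝ, ∀ x ∈ c, x + (κ - 2 * ⟪ν, x⟫) • ν ∈ c := by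
  have hrefl : ∀ x, reflectAcross ν q x = x - (2 * ⟪ν, x - q⟫) • ν := by
    intro x
    rw [reflectAcross, Submodule.reflection_orthogonal_apply, Submodule.reflection_singleton_apply,
      hν]
    simp only [RCLike.ofReal_real_eq_id, id_eq, one_pow, div_one]
    module
  set k : Sp n := (2 * ⟪ν, q⟫) • ν - v with hk
  have hg : ∀ x ∈ c, x - (2 * ⟪ν, x⟫) • ν + k ∈ c := by
    intro x hx
    have hmem : reflectAcross ν q x ∈ (fun x => x + v) '' c := h ▸ mem_image_of_mem _ hx
    obtain ⟨z, hz, hzx⟩ := hmem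
    have : x - (2 * ⟪ν, x⟫) • ν + k = z := by
      have hzx' : z + v = reflectAcross ν q x := hzx
      rw [eq_sub_of_add_eq hzx', hrefl, hk, inner_sub_right]
      module
    rwa [this]
  have hνν : ⟪ν, ν⟫ = (1 : ℝ) := by rw [real_inner_self_eq_norm_sq, hν, one_pow]
  have htwo : ∀ x ∈ c, x + (2 : ℝ) • (k - ⟪ν, k⟫ • ν) ∈ c := by
    intro x hx
    have := hg _ (hg x hx)
    rw [inner_add_right, inner_sub_right, real_inner_smul_right, hνν] at this
    convert this using 1
    module
  have hiter : ∀ x ∈ c, ∀ m : ℕ, x + (m : ℝ) • (2 : ℝ) • (k - ⟪ν, k⟫ • ν) ∈ c := by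
    intro x hx m
    induction m with
    | zero => simpa using hx
    | succ m ih =>
      convert htwo _ ih using 1
      push_cast
      module
  obtain ⟨R, hR⟩ := hc.exists_norm_le
  obtain ⟨x, hx⟩ := hne
  have hk0 : k - ⟪ν, k⟫ • ν = 0 := by
    by_contra hne0
    have hpos : 0 < ‖(2 : ℝ) • (k - ⟪ν, k⟫ • ν)‖ := norm_pos_iff.mpr (by simpa using hne0)
    obtain ⟨m, hm⟩ := exists_nat_gt ((R + ‖x‖) / ‖(2 : ℝ) • (k - ⟪ν, k⟫ • ν)‖)
    rw [div_lt_iff₀ hpos] at hm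
    have h1 := hR _ (hiter x hx m)
    have h2 := norm_sub_le (x + (m : ℝ) • (2 : ℝ) • (k - ⟪ν, k⟫ • ν)) x
    rw [add_sub_cancel_left, norm_smul, Real.norm_natCast] at h2
    linarith
  refine ⟨⟪ν, k⟫, fun x hx => ?_⟩
  have := hg x hx
  rw [sub_eq_zero.mp hk0] at this
  convert this using 1
  module

/-! ### Flat points and facets -/

open Topology in
theorem not_aeConstNear_indicator_of_flat {n : ℕ} {c : Set (Sp n)} {μ ν x y : Sp n} {ε r : ℝ}
    (hflat : ∀ z ∈ Metric.ball x ε, z ∈ c ↔ ⟪μ, z - x⟫ ≤ 0) (hpos : 0 < ⟪μ, ν⟫)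
    (hr : ⟪μ, y + r • ν - x⟫ = 0) (hball : y + r • ν ∈ Metric.ball x ε) :
    ¬ AEConstNear (fun s => c.indicator (fun _ => (1 : ℝ)) (y + s • ν)) r := by
  intro hconst
  have hnear : ∀ᶠ s in 𝓝 r, y + s • ν ∈ Metric.ball x ε :=
    (by fun_prop : Continuous fun s : ℝ => y + s • ν).continuousAt.eventually
      (Metric.isOpen_ball.mem_nhds hball)
  have hin : ∀ s : ℝ, ⟪μ, y + s • ν - x⟫ = (s - r) * ⟪μ, ν⟫ := by
    intro s
    have : y + s • ν - x = (y + r • ν - x) + (s - r) • ν := by module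
    rw [this, inner_add_right, hr, real_inner_smul_right, zero_add]
  refine zero_ne_one (α := ℝ) (hconst.eq_of_sides ?_ ?_)
  · filter_upwards [hnear.filter_mono nhdsWithin_le_nhds, self_mem_nhdsWithin] with s hs hlt
    refine indicator_of_notMem (fun hsc => ?_) _
    rw [hflat _ hs, hin] at hsc
    exact absurd hsc (not_le.mpr (mul_pos (sub_pos.mpr hlt) hpos))
  · filter_upwards [hnear.filter_mono nhdsWithin_le_nhds, self_mem_nhdsWithin] with s hs hlt
    refine indicator_of_mem ?_ _
    rw [hflat _ hs, hin]
    exact mul_nonpos_of_nonpos_of_nonneg (sub_nonpos.mpr (le_of_lt hlt)) hpos.le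

open Topology in
/-- The indicator function of a set jumps across its flat points, on every nearby line that is
transversal to them. -/
theorem eventually_not_aeConstNear_of_mem_flatPoints {n : ℕ} {c : Set (Sp n)} {μ ν x : Sp n}
    (hx : x ∈ flatPoints c μ) (hpos : 0 < ⟪μ, ν⟫) :
    ∀ᶠ y in 𝓝 x, ¬ AEConstNear (fun s => c.indicator (fun _ => (1 : ℝ)) (y + s • ν))
      (-⟪μ, y - x⟫ / ⟪μ, ν⟫) := by
  obtain ⟨ε, hε, hflat⟩ := hx
  have hcont : Continuous fun y : Sp n => y + (-⟪μ, y - x⟫ / ⟪μ, ν⟫) • ν := by fun_prop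
  have hball : ∀ᶠ y in 𝓝 x, y + (-⟪μ, y - x⟫ / ⟪μ, ν⟫) • ν ∈ Metric.ball x ε :=
    hcont.continuousAt.eventually (Metric.isOpen_ball.mem_nhds (by simpa using hε))
  filter_upwards [hball] with y hy
  refine not_aeConstNear_indicator_of_flat hflat hpos ?_ hy
  rw [add_sub_right_comm, inner_add_right, real_inner_smul_right]
  field_simp
  ring

theorem not_hasNoFacetJump_indicator {n : ℕ} {c : Set (Sp n)} {ν x : Sp n} (hν : ‖ν‖ = 1)
    (hx : x ∈ flatPoints c ν) : ¬ HasNoFacetJump ν (c.indicator fun _ => (1 : ℝ)) := by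
  intro h
  have hνν : ⟪ν, ν⟫ = (1 : ℝ) := by rw [real_inner_self_eq_norm_sq, hν, one_pow]
  obtain ⟨y, hy1, hy2⟩ := (Measure.dense_of_ae (h ⟪ν, x⟫)).inter_nhds_nonempty
    (eventually_not_aeConstNear_of_mem_flatPoints hx (hνν ▸ one_pos))
  refine hy2 ?_
  have e : -⟪ν, y - x⟫ / ⟪ν, ν⟫ = ⟪ν, x⟫ - ⟪ν, y⟫ := by
    rw [hνν, inner_sub_right]; ring
  rw [e]
  exact hy1

theorem not_hasOnlyFacetJumps_indicator {n : ℕ} {c : Set (Sp n)} {μ ν x : Sp n} (hμ : ‖μ‖ = 1)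
    (hν : ‖ν‖ = 1) (hμν : μ ≠ ν) (hpos : 0 < ⟪μ, ν⟫) (hx : x ∈ flatPoints c μ) :
    ¬ HasOnlyFacetJumps ν (c.indicator fun _ => (1 : ℝ)) := by
  rintro ⟨B, hB⟩
  -- This vector is the gradient of the height at which the line through `y` crosses the oblique
  -- facet. As it is nonzero, almost every line crosses at a height outside the finite set `B`.
  have ha : ν - ⟪μ, ν⟫⁻¹ • μ ≠ 0 := by
    intro h0
    have h1 : ν = ⟪μ, ν⟫⁻¹ • μ := sub_eq_zero.mp h0
    have h2 := congrArg norm h1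
    rw [norm_smul, hμ, hν, mul_one, Real.norm_eq_abs, abs_of_pos (inv_pos.mpr hpos)] at h2
    rw [← h2, one_smul] at h1
    exact hμν h1.symm
  have hae := hB.and ((Filter.eventually_all_finset B).mpr fun b _ =>
    ae_inner_ne ha (b - ⟪μ, ν⟫⁻¹ * ⟪μ, x⟫))
  obtain ⟨y, ⟨hy1, hy3⟩, hy2⟩ := (Measure.dense_of_ae hae).inter_nhds_nonempty
    (eventually_not_aeConstNear_of_mem_flatPoints hx hpos)
  refine hy2 ?_
  have e : -⟪μ, y - x⟫ / ⟪μ, ν⟫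
      = (⟪ν - ⟪μ, ν⟫⁻¹ • μ, y⟫ + ⟪μ, ν⟫⁻¹ * ⟪μ, x⟫) - ⟪ν, y⟫ := by
    rw [inner_sub_right, inner_sub_left, real_inner_smul_left]
    field_simp
    ring
  rw [e]
  exact hy1 _ fun hb => hy3 _ hb (by ring)

open Topology in
/-- Near a flat point, the flat points with the same normal form a disc. -/
theorem exists_mem_flatPoints_iff {n : ℕ} {c : Set (Sp n)} {ν x : Sp n} (hν : ‖ν‖ = 1)
    (hx : x ∈ flatPoints c ν) :
    ∃ ε > 0, ∀ y ∈ Metric.ball x ε, y ∈ flatPoints c ν ↔ ⟪ν, y⟫ = ⟪ν, x⟫ := by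
  obtain ⟨ε, hε, hflat⟩ := hx
  refine ⟨ε, hε, fun y hy => ⟨?_, fun h => ?_⟩⟩
  · rintro ⟨δ, hδ, hyflat⟩
    have h1 : ⟪ν, y - x⟫ ≤ 0 := (hflat y hy).mp ((hyflat y (Metric.mem_ball_self hδ)).mpr (by simp))
    rw [inner_sub_right] at h1
    refine le_antisymm (by linarith) ?_
    by_contra! hlt
    have hcont : Continuous fun s : ℝ => y + s • ν := by fun_prop
    have hev : ∀ᶠ s in 𝓝[>] (0 : ℝ), y + s • ν ∈ Metric.ball x ε ∧ y + s • ν ∈ Metric.ball y δ ∧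
        s < ⟪ν, x⟫ - ⟪ν, y⟫ := by
      refine Eventually.filter_mono nhdsWithin_le_nhds ?_
      refine (hcont.continuousAt.eventually (Metric.isOpen_ball.mem_nhds (by simpa using hy))).and
        ((hcont.continuousAt.eventually (Metric.isOpen_ball.mem_nhds (by simpa using hδ))).and
          (Iio_mem_nhds (by linarith)))
    obtain ⟨s, ⟨hs1, hs2, hs3⟩, hs0⟩ := (hev.and self_mem_nhdsWithin).exists
    have hs0' : 0 < s := hs0
    have hνν : ⟪ν, ν⟫ = (1 : ℝ) := by rw [real_inner_self_eq_norm_sq, hν, one_pow]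
    have h2 : y + s • ν ∈ c := by
      rw [hflat _ hs1, inner_sub_right, inner_add_right, real_inner_smul_right, hνν]
      linarith
    rw [hyflat _ hs2, add_sub_cancel_left, real_inner_smul_right, hνν] at h2
    linarith
  · refine ⟨ε - dist y x, sub_pos.mpr hy, fun z hz => ?_⟩
    rw [hflat z (Metric.ball_subset (by simp) hz), inner_sub_right, inner_sub_right, h]

/-- By `exists_mem_flatPoints_iff` the height is locally constant on flat points, hence constant on
a component and on its closure. -/
theorem inner_eq_of_mem_facet {n : ℕ} {c : Set (Sp n)} {ν x y : Sp n} (hν : ‖ν‖ = 1)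
    (hx : x ∈ flatPoints c ν)
    (hy : y ∈ closure (connectedComponentIn (flatPoints c ν) x)) : ⟪ν, y⟫ = ⟪ν, x⟫ := by
  have hcomp : ∀ z ∈ connectedComponentIn (flatPoints c ν) x, ⟪ν, z⟫ = ⟪ν, x⟫ := by
    intro z hz
    have := Subtype.preconnectedSpace
      (isPreconnected_connectedComponentIn (x := x) (F := flatPoints c ν))
    have hloc : IsLocallyConstant fun z : connectedComponentIn (flatPoints c ν) x => ⟪ν, z.1⟫ := by
      rw [IsLocallyConstant.iff_eventually_eq]
      intro z
      obtain ⟨ε, hε, h⟩ := exists_mem_flatPoints_iff hν (connectedComponentIn_subset _ _ z.2)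
      filter_upwards [continuous_subtype_val.continuousAt.eventually
        (Metric.ball_mem_nhds z.1 hε)] with z' hz'
      exact (h _ hz').mp (connectedComponentIn_subset _ _ z'.2)
    exact hloc.apply_eq_of_preconnectedSpace ⟨z, hz⟩ ⟨x, mem_connectedComponentIn hx⟩
  have hclosed : IsClosed {z : Sp n | ⟪ν, z⟫ = ⟪ν, x⟫} := isClosed_eq (by fun_prop) (by fun_prop)
  exact closure_minimal hcomp hclosed hy

/-- Two facets with the same normal that share a piece of a hyperplane are equal. -/
theorem IsFacet.eq_of_disc {n : ℕ} {c : Set (Sp n)} {ν p : Sp n} {f g : Set (Sp n)} {ε : ℝ}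
    (hf : IsFacet c ν f) (hg : IsFacet c ν g) (hε : 0 < ε)
    (h : ∀ y ∈ Metric.ball p ε, ⟪ν, y - p⟫ = 0 → y ∈ f ∧ y ∈ g) : f = g := by
  obtain ⟨hν, x, hx, rfl⟩ := hf
  obtain ⟨-, x', hx', rfl⟩ := hg
  have hp := (h p (Metric.mem_ball_self hε) (by simp)).1
  obtain ⟨z, hzb, hz⟩ := mem_closure_iff.mp hp _ Metric.isOpen_ball (Metric.mem_ball_self hε)
  have hzp : ⟪ν, z - p⟫ = 0 := by
    rw [inner_sub_right, inner_eq_of_mem_facet hν hx hp,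
      inner_eq_of_mem_facet hν hx (subset_closure hz), sub_self]
  obtain ⟨δ, hδ, hflat⟩ := exists_mem_flatPoints_iff hν (connectedComponentIn_subset _ _ hz)
  obtain ⟨z', hz'b, hz'⟩ := mem_closure_iff.mp (h z hzb hzp).2 _ Metric.isOpen_ball
    (Metric.mem_ball_self hδ)
  -- This disc of flat points contains a point of each component, so the components coincide.
  have hconv : Convex ℝ (Metric.ball z δ ∩ {y | ⟪ν, y⟫ = ⟪ν, z⟫}) :=
    (convex_ball z δ).inter (convex_hyperplane (innerₗ _ ν).isLinear _)
  have hsub := hconv.isPreconnected.subset_connectedComponentIn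
    (F := flatPoints c ν) (x := z) ⟨Metric.mem_ball_self hδ, rfl⟩
    fun y hy => (hflat y hy.1).mpr hy.2
  have hz'z := hsub ⟨hz'b, (hflat z' hz'b).mp (connectedComponentIn_subset _ _ hz')⟩
  rw [connectedComponentIn_eq hz, connectedComponentIn_eq hz', connectedComponentIn_eq hz'z]

/-- With equal normals the wedge degenerates, and both facets would contain a whole disc around `p`.
-/
theorem MeetAtAngle.normal_ne {n : ℕ} {c : Set (Sp n)} {ν μ : Sp n} {f g : Set (Sp n)} {θ : ℝ}
    (h : MeetAtAngle c ν f μ g θ) : ν ≠ μ := by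
  rintro rfl
  obtain ⟨hf, hg, hne, p, ε, hε, ⟨-, H⟩ | ⟨-, H⟩⟩ := h
  · exact hne (hf.eq_of_disc hg hε fun y hy h0 => ⟨(H y hy).1 h0 h0.le, (H y hy).2.1 h0 h0.le⟩)
  · exact hne (hf.eq_of_disc hg hε fun y hy h0 => ⟨(H y hy).1 h0 h0.ge, (H y hy).2.1 h0 h0.ge⟩)

/-! ### The main argument -/

/-- A polyhedral body that is symmetric with respect to a hyperplane with normal `ν`, and that has
both a facet with normal `ν` and an oblique facet, is not a combination of its own reduced
copies. -/
theorem IsPolyhedralCell.not_refinement {n m : ℕ} {c : Set (Sp n)} (hc : IsPolyhedralCell c)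
    {μ ν x₀ x₁ : Sp n} {κ h : ℝ} (hμ : ‖μ‖ = 1) (hν : ‖ν‖ = 1) (hμν : μ ≠ ν) (hpos : 0 < ⟪μ, ν⟫)
    (hx₀ : x₀ ∈ flatPoints c ν) (hx₁ : x₁ ∈ flatPoints c μ)
    (hsym : ∀ x ∈ c, x + (κ - 2 * ⟪ν, x⟫) • ν ∈ c) (h0 : 0 < h) (h1 : h < 1)
    (a : Fin m → ℝ) (w : Fin m → Sp n) :
    ¬ c.indicator (fun _ => (1 : ℝ)) =ᵐ[volume]
      fun x => ∑ i, a i * c.indicator (fun _ => (1 : ℝ)) (h⁻¹ • (x - w i)) := by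
  classical
  intro href
  set φ : Sp n → ℝ := c.indicator fun _ => (1 : ℝ) with hφ
  obtain ⟨H, hH0, hH⟩ := hc.polyhedral
  obtain ⟨R, hRpos, hR⟩ := hc.isCompact.isBounded.exists_pos_norm_le
  have hmeas : MeasurableSet c := hc.isCompact.isClosed.measurableSet
  have hφm : Measurable φ := measurable_const.indicator hmeas
  have hφ1 : ∀ x, |φ x| ≤ 1 := fun x => by
    by_cases hx : x ∈ c <;> simp [hφ, hx]
  -- For `p.1` parallel to `ν` this is the height of the hyperplane. Other `p`, including those with
  -- a zero denominator, and the mirror images added in `B` contribute superfluous heights, which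
  -- are harmless.
  set B₀ : Finset ℝ := H.image fun p => p.2 / ⟪p.1, ν⟫ with hB₀
  set B : Finset ℝ := B₀ ∪ B₀.image fun b => κ - b with hB
  have hBsym : ∀ b ∈ B, κ - b ∈ B := by
    intro b hb
    rcases Finset.mem_union.mp hb with hb | hb
    · exact Finset.mem_union_right _ (Finset.mem_image_of_mem _ hb)
    · obtain ⟨b', hb', rfl⟩ := Finset.mem_image.mp hb
      rw [sub_sub_cancel]
      exact Finset.mem_union_left _ hb'
  have hBH : ∀ p ∈ H, p.2 / ⟪p.1, ν⟫ ∈ B := fun p hp =>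
    Finset.mem_union_left _ (Finset.mem_image_of_mem (fun p : Sp n × ℝ => p.2 / ⟪p.1, ν⟫) hp)
  set ψ : Sp n → ℝ := facetPart c ν B with hψ
  have hψm : Measurable ψ := measurable_facetPart hmeas ν B
  set M : ℝ := ∑ b ∈ B, |b| with hM
  have hM0 : 0 ≤ M := Finset.sum_nonneg fun b _ => abs_nonneg b
  have hψR : ∀ x, 2 * R + M < ‖x‖ → ψ x = 0 := fun x hx =>
    facetPart_eq_zero_of_norm_gt hν hsym hBsym hR
      (fun b hb => Finset.single_le_sum (fun b _ => abs_nonneg b) hb) hx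
  have hφR : ∀ x, 2 * R + M < ‖x‖ → φ x = 0 := fun x hx =>
    indicator_of_notMem (fun hxc => by linarith [hR x hxc]) _
  have hψonly : HasOnlyFacetJumps ν ψ := hasOnlyFacetJumps_facetPart c hν B
  have hθno : HasNoFacetJump ν fun x => φ x - ψ x := hasNoFacetJump_sub_facetPart hν hH0 hH hBH
  have hψref : ψ =ᵐ[volume] fun x => ∑ i, a i * ψ (h⁻¹ • (x - w i)) := by
    have hno : HasNoFacetJump ν fun x => ψ x - ∑ i, a i * ψ (h⁻¹ • (x - w i)) := by
      refine ((hθno.refine h0.ne' a w).const_mul (-1)).congr_ae ?_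
      filter_upwards [href] with x hx
      simp only [hx, mul_sub, Finset.sum_sub_distrib]
      ring
    -- Beyond this radius `‖x - w i‖` exceeds `2 * R + M`, and multiplication by `h⁻¹ ≥ 1` only
    -- increases it.
    have hzero := HasOnlyFacetJumps.ae_eq_zero hν (R := 2 * R + M + ∑ i, ‖w i‖)
      (by fun_prop) (fun x hx => ?_) (hψonly.refine h0.ne' a w) hno
    · filter_upwards [hzero] with x hx
      exact sub_eq_zero.mp hx
    · have hw : 0 ≤ ∑ i, ‖w i‖ := Finset.sum_nonneg fun i _ => norm_nonneg _
      rw [hψR x (by linarith), zero_sub, neg_eq_zero]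
      refine Finset.sum_eq_zero fun i _ => ?_
      have hwi : ‖w i‖ ≤ ∑ i, ‖w i‖ :=
        Finset.single_le_sum (f := fun i => ‖w i‖) (fun i _ => norm_nonneg _) (Finset.mem_univ i)
      have hsub := norm_sub_norm_le x (w i)
      have hh : 1 ≤ h⁻¹ := (one_le_inv₀ h0).mpr h1.le
      rw [hψR, mul_zero]
      rw [norm_smul, Real.norm_eq_abs, abs_of_pos (inv_pos.mpr h0)]
      have := mul_le_mul_of_nonneg_right hh (norm_nonneg (x - w i))
      linarith
  have hφint : Integrable φ := integrable_of_bounded_support hφm hφ1 hφR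
  have hψint : Integrable ψ := integrable_of_bounded_support hψm (abs_facetPart_le c ν B) hψR
  set V : ℝ := ∫ x, φ x with hV
  have hVpos : 0 < V := by
    have e : V = volume.real c := integral_indicator_one hmeas
    rw [e]
    refine ENNReal.toReal_pos ?_ hc.isCompact.measure_lt_top.ne
    exact (lt_of_lt_of_le (isOpen_interior.measure_pos volume hc.connected.nonempty)
      (measure_mono interior_subset)).ne'
  -- Integrate the refinement equation of `φ` and divide by the positive volume.
  have ha : (∑ i, a i) * h ^ n = 1 := by
    have hi : ∀ i, Integrable fun x => φ (h⁻¹ • (x - w i)) := fun i =>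
      (hφint.comp_smul (inv_ne_zero h0.ne')).comp_sub_right (w i)
    have : V = (∑ i, a i) * h ^ n * V := by
      calc V = ∫ x, ∑ i, a i * φ (h⁻¹ • (x - w i)) := integral_congr_ae href
        _ = ∑ i, a i * (h ^ n * V) := by
          rw [integral_finsetSum _ fun i _ => (hi i).const_mul _]
          simp_rw [integral_const_mul, integral_dilation φ h0]
          rfl
        _ = _ := by rw [← Finset.sum_mul]; ring
    have h2 : ((∑ i, a i) * h ^ n - 1) * V = 0 := by linarith
    linarith [(mul_eq_zero.mp h2).resolve_right hVpos.ne']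
  -- Chosen so that `ψ - l * φ` has integral zero, as the uniqueness theorem requires.
  set l : ℝ := (∫ x, ψ x) / V with hl
  have hprop : (fun x => ψ x - l * φ x) =ᵐ[volume] 0 := by
    refine ae_eq_zero_of_refinement (C := B.card + |l|) (R := 2 * R + M) (by fun_prop)
      (fun x => ?_) (fun x hx => ?_) h0 h1 a w ha ?_ ?_
    · refine (abs_sub _ _).trans (add_le_add (abs_facetPart_le c ν B x) ?_)
      rw [abs_mul]
      exact mul_le_of_le_one_right (abs_nonneg _) (hφ1 x)
    · rw [hψR x hx, hφR x hx, mul_zero, sub_zero]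
    · filter_upwards [href, hψref] with x hx1 hx2
      rw [hx1, hx2, Finset.mul_sum, ← Finset.sum_sub_distrib]
      exact Finset.sum_congr rfl fun i _ => by ring
    · rw [integral_sub hψint (hφint.const_mul l), integral_const_mul, hl,
        div_mul_cancel₀ _ hVpos.ne', sub_self]
  by_cases hl0 : l = 0
  · refine not_hasNoFacetJump_indicator hν hx₀ (hθno.congr_ae ?_)
    filter_upwards [hprop] with x hx
    simp only [hl0, zero_mul, sub_zero, Pi.zero_apply] at hx
    rw [hx, sub_zero]
  · refine not_hasOnlyFacetJumps_indicator hμ hν hμν hpos hx₁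
      ((hψonly.const_mul l⁻¹).congr_ae ?_)
    filter_upwards [hprop] with x hx
    rw [sub_eq_zero.mp hx, inv_mul_cancel_left₀ hl0]

theorem exists_refinement_of_mem_cellSpan {n J : ℕ} {c : Set (Sp n)}
    {T : Fin (J + 1) → Set (Set (Sp n))} (hT : ∀ j, IsTessellationByShifts c (T j)) {h : ℝ}
    (h0 : h ≠ 0) {t : Sp n} {s : Sp n → ℝ} (hs : s ∈ cellSpan (⋃ i, scaledCopy h t (T i))) :
    ∃ (m : ℕ) (a : Fin m → ℝ) (w : Fin m → Sp n),
      s = fun x => ∑ i, a i * c.indicator (fun _ => (1 : ℝ)) (h⁻¹ • (x - w i)) := by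
  classical
  obtain ⟨m, a, g, rfl⟩ := (Submodule.mem_span_set' (R := ℝ)).mp hs
  have hg : ∀ i, ∃ w : Sp n,
      (g i : Sp n → ℝ) = fun x => c.indicator (fun _ => (1 : ℝ)) (h⁻¹ • (x - w)) := by
    intro i
    obtain ⟨_, hd, hdg⟩ := (g i).2
    obtain ⟨j, d, hdT, rfl⟩ := mem_iUnion.mp hd
    obtain ⟨v, rfl⟩ := (hT j).1 d hdT
    refine ⟨h • v + t, ?_⟩
    rw [← hdg]
    funext x
    have hiff : x ∈ (fun x => h • x + t) '' ((fun x => x + v) '' c) ↔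
        h⁻¹ • (x - (h • v + t)) ∈ c := by
      rw [image_image]
      constructor
      · rintro ⟨z, hz, rfl⟩
        convert hz using 1
        rw [show h • (z + v) + t - (h • v + t) = h • z by module, inv_smul_smul₀ h0]
      · intro hx
        refine ⟨_, hx, ?_⟩
        simp only [smul_add, smul_inv_smul₀ h0]
        abel
    simp only [indicator_apply, hiff]
  choose w hw using hg
  refine ⟨m, a, w, ?_⟩
  funext x
  simp [hw]

theorem mainTheorem6 {n J : ℕ} (c : Set (Sp n)) (hc : IsPolyhedralCell c)
    (T : Fin (J + 1) → Set (Set (Sp n)))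
    (hT : ∀ j, IsTessellationByShifts c (T j)) (hcT : c ∈ T 0) (heff : IsEfficient T)
    (νa νb : Sp n) (fa fb : Set (Sp n)) (γ : ℝ)
    (hmeet : MeetAtAngle c νa fa νb fb γ) (hobtuse : 0 < ⟪νa, νb⟫)
    (hangle : ∀ (ν : Sp n) (f : Set (Sp n)) (θ : ℝ),
      MeetAtAngle c ν f νb fb θ → Real.pi - γ ≤ θ)
    (q : Sp n) (hq : q ∈ fb) (hreflect : reflectAcross νb q '' c ∈ T 0) :
    ¬ IsRefinable T := by
  rintro ⟨h, t, h0, h1, href⟩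
  obtain ⟨s, hs, hsc⟩ := href 0 c hcT
  obtain ⟨m, a, w, rfl⟩ := exists_refinement_of_mem_cellSpan hT h0.ne' hs
  have hne := hmeet.normal_ne
  obtain ⟨⟨hνa, xa, hxa, -⟩, ⟨hνb, xb, hxb, -⟩, -⟩ := hmeet
  obtain ⟨v, hv⟩ := (hT 0).1 _ hreflect
  obtain ⟨κ, hκ⟩ := exists_symmetry_of_reflectAcross hc.isCompact.isBounded
    (hc.connected.nonempty.mono interior_subset) hνb hv
  exact hc.not_refinement hνa hνb hne hobtuse hxb hxa hκ h0 h1 a w hsc.symm
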